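/- Let $t\ge 1$ be an integer, $\varepsilon\in(0,1)$ and $d=\lceil\sqrt{2t\ln(24/\varepsilon)}\,\rceil$. Let $H$ be a Hermitian operator on a finite-dimensional Hilbert space $\mathcal H$ (for example $s$ qubits) with spectral norm $\|H\|=1$. Let $U_H$ be a unitary on $(\mathbb C^2)^{\otimes a}\otimes\mathcal H$ with $U_H^2=I$ that is a $(1,a,\delta)$-block encoding of $H$, i.e. $\|H-(\langle\bar 0|\otimes I)U_H(|\bar 0\rangle\otimes I)\|\le\delta$ with $|\bar 0\rangle=|0\rangle^{\otimes a}$, where $$\delta\le\frac{\varepsilon^2}{1152\,t\ln(24/\varepsilon)}.$$ Put $R=(2|\bar 0\rangle\langle\bar 0|-I)\otimes I$ and $V=R\,U_H$. If $t$ is even, let $c_0=2^{-t}\binom{t}{t/2}$, $c_\ell=2^{1-t}\binom{t}{t/2+\ell}$ for $1\le \ell\le\lfloor d/2\rfloor$, and $k_\ell=2\ell$. If $t$ is odd, let $c_\ell=2^{1-t}\binom{t}{(t+1)/2+\ell}$ for $0\le\ell\le\lfloor (d-1)/2\rfloor$, and $k_\ell=2\ell+1$. Let $\|c\|_1=\sum_\ell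 c_\ell$, the sum being over the stated range of $\ell$. Let $|\psi_0\rangle\in\mathcal H$ be a unit vector, $\rho_0=|\psi_0\rangle\langle\psi_0|$, and $\Pi$ an orthogonal projector on $\mathcal H$. Consider the algorithm that samples $\ell$ with probability $c_\ell/\|c\|_1$ and applies $V^{k_\ell}$ to $|\bar 0\rangle|\psi_0\rangle$, using no further qubits. It outputs a density matrix $\rho$ whose expectation is $$\mathbb E[\rho]=\bar\rho:=\sum_\ell\frac{c_\ell}{\|c\|_1}\,V^{k_\ell}\,(|\bar 0\rangle\langle\bar 0|\otimes\rho_0)\,V^{-k_\ell},$$ and $$\mathrm{Tr}[(I\otimes\Pi)\bar\rho]\;\ge\;\mathrm{Tr}[\Pi H^t\rho_0H^t]-\varepsilon .$$ Every run makes at most $d$ queries to $V$. In particular it makes $O(\sqrt{t\log(1/\varepsilon)})$ queries: for every $\varepsilon_0\in(0,1)$ there is a constant $C$ depending only on $\varepsilon_0$ such that, whenever $\varepsilon\le\varepsilon_0$, every run makes at most $C\sqrt{t\log(1/\varepsilon)}$ queries. -/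

import Mathlib

open scoped Kronecker Matrix Matrix.Norms.L2Operator ComplexOrder

noncomputable section

namespace AncillaFree

/-! ### Registers and block encodings

The spectral norm of a matrix is the norm `Matrix.Norms.L2Operator`. An `a`-qubit ancilla register has
computational basis `Fin a → Fin 2`, with `|0̄⟩` the basis vector of `0`. The system register has an
arbitrary finite basis `ι` (`s` qubits: `ι = Fin s → Fin 2`). -/

/-- The computational basis of an `a`-qubit ancilla register next to a system register with basis `ι`. -/
abbrev Reg (a : ℕ) (ι : Type*) : Type _ := (Fin a → Fin 2) × ι

/-- The projector `|0̄⟩⟨0̄|` on the ancilla register. -/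
def zeroProj (a : ℕ) : Matrix (Fin a → Fin 2) (Fin a → Fin 2) ℂ := Matrix.single 0 0 1

/-- The isometry `|0̄⟩ ⊗ I` from the system register to the full register. -/
def ketZero (a : ℕ) (ι : Type*) [DecidableEq ι] : Matrix (Reg a ι) ι ℂ :=
  Matrix.of fun p i => if p = (0, i) then 1 else 0

/-- `U` is an `(α, a, δ)`-block encoding of `H`:
`U` is unitary and `‖H - α (⟨0̄| ⊗ I) U (|0̄⟩ ⊗ I)‖ ≤ δ`. -/
def IsBlockEncoding {ι : Type*} [Fintype ι] [DecidableEq ι] (α : ℝ) (a : ℕ) (δ : ℝ)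
    (H : Matrix ι ι ℂ) (U : Matrix (Reg a ι) (Reg a ι) ℂ) : Prop :=
  0 < α ∧ U ∈ Matrix.unitaryGroup (Reg a ι) ℂ ∧
    ‖H - (α : ℂ) • ((ketZero a ι)ᴴ * U * ketZero a ι)‖ ≤ δ

/-- The reflection `R = (2|0̄⟩⟨0̄| - I) ⊗ I`. -/
def reflection (a : ℕ) (ι : Type*) [DecidableEq ι] : Matrix (Reg a ι) (Reg a ι) ℂ :=
  ((2 : ℂ) • zeroProj a - 1) ⊗ₖ (1 : Matrix ι ι ℂ)

/-- The walk operator `V = R · U`. -/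
def walk {a : ℕ} {ι : Type*} [Fintype ι] [DecidableEq ι] (U : Matrix (Reg a ι) (Reg a ι) ℂ) :
    Matrix (Reg a ι) (Reg a ι) ℂ :=
  reflection a ι * U

/-- The pure state `|ψ⟩⟨ψ|`. -/
def pureState {ι : Type*} (ψ : EuclideanSpace ℂ ι) : Matrix ι ι ℂ :=
  Matrix.vecMulVec (fun i => ψ i) (fun i => star (ψ i))

/-- The state `|0̄⟩⟨0̄| ⊗ ρ` of the full register. -/
def withAncilla (a : ℕ) {ι : Type*} (ρ : Matrix ι ι ℂ) : Matrix (Reg a ι) (Reg a ι) ℂ :=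
  zeroProj a ⊗ₖ ρ

/-- Density matrices: positive semidefinite matrices of trace one. -/
def IsDensityMatrix {n : Type*} [Fintype n] (ρ : Matrix n n ℂ) : Prop :=
  ρ.PosSemidef ∧ ρ.trace = 1

/-! ### Circuits with queries to a unitary -/

/-- One gate of a circuit on a register with basis `n`: a query to the black-box unitary, or a fixed
unitary that is not charged for. -/
inductive Gate (n : Type*) [Fintype n] [DecidableEq n]
  | query : Gate n
  | free (W : Matrix.unitaryGroup n ℂ) : Gate n

/-- The state after a gate, when the queried unitary is `V`. -/
def Gate.apply {n : Type*} [Fintype n] [DecidableEq n] (V : Matrix n n ℂ) :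
    Matrix n n ℂ → Gate n → Matrix n n ℂ
  | ρ, .query => V * ρ * Vᴴ
  | ρ, .free W => (W : Matrix n n ℂ) * ρ * (W : Matrix n n ℂ)ᴴ

/-- The number of queries made by a gate. -/
def Gate.cost {n : Type*} [Fintype n] [DecidableEq n] : Gate n → ℕ
  | .query => 1
  | .free _ => 0

/-- A circuit on the register with basis `n` (no further qubits): its gates, in order of application. -/
abbrev Circuit (n : Type*) [Fintype n] [DecidableEq n] : Type _ := List (Gate n)

/-- The output state of a circuit on input `ρ`, when the queried unitary is `V`. -/
def Circuit.run {n : Type*} [Fintype n] [DecidableEq n] (C : Circuit n) (V ρ : Matrix n n ℂ) :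
    Matrix n n ℂ :=
  List.foldl (Gate.apply V) ρ C

/-- The number of queries made by a circuit. -/
def Circuit.queries {n : Type*} [Fintype n] [DecidableEq n] (C : Circuit n) : ℕ :=
  (List.map Gate.cost C).sum

/-! ### The coefficients and the sampling algorithm -/

/-- The coefficients in `x ^ t = ∑ ℓ, c ℓ * T_{2ℓ}(x)` (even `t`) and
`x ^ t = ∑ ℓ, c ℓ * T_{2ℓ+1}(x)` (odd `t`). -/
def coeff (t ℓ : ℕ) : ℝ :=
  if Even t then
    if ℓ = 0 then (2 : ℝ) ^ (-(t : ℤ)) * (t.choose (t / 2) : ℝ)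
    else (2 : ℝ) ^ (1 - (t : ℤ)) * (t.choose (t / 2 + ℓ) : ℝ)
  else (2 : ℝ) ^ (1 - (t : ℤ)) * (t.choose ((t + 1) / 2 + ℓ) : ℝ)

/-- The largest sampled index: `⌊d/2⌋` for even `t` and `⌊(d-1)/2⌋` for odd `t`. -/
def maxIndex (t d : ℕ) : ℕ := if Even t then d / 2 else (d - 1) / 2

/-- The power of the walk operator that belongs to the index `ℓ`. -/
def power (t ℓ : ℕ) : ℕ := if Even t then 2 * ℓ else 2 * ℓ + 1

/-- `‖c‖₁`, the sum of the absolute values of the coefficients that are sampled from. -/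
def coeffNorm (t d : ℕ) : ℝ := ∑ ℓ : Fin (maxIndex t d + 1), |coeff t ℓ|

theorem coeff_nonneg (t ℓ : ℕ) : 0 ≤ coeff t ℓ := by
  unfold coeff
  split_ifs <;> positivity

theorem coeff_zero_pos (t : ℕ) : 0 < coeff t 0 := by
  unfold coeff
  by_cases h : Even t
  · have h1 : 0 < t.choose (t / 2) := Nat.choose_pos (Nat.div_le_self t 2)
    rw [if_pos h, if_pos rfl]
    positivity
  · have h0 : t ≠ 0 := by
      rintro rfl
      exact h Even.zero
    have h1 : 0 < t.choose ((t + 1) / 2 + 0) := Nat.choose_pos (by omega)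
    rw [if_neg h]
    positivity

theorem coeffNorm_pos (t d : ℕ) : 0 < coeffNorm t d := by
  unfold coeffNorm
  refine Finset.sum_pos' (fun ℓ _ => abs_nonneg _) ⟨0, Finset.mem_univ _, ?_⟩
  simpa using (coeff_zero_pos t).ne'

/-- The distribution that picks `ℓ ∈ {0, …, maxIndex t d}` with probability `c ℓ / ‖c‖₁`. -/
def law (t d : ℕ) : PMF (Fin (maxIndex t d + 1)) :=
  PMF.ofFintype (fun ℓ => ENNReal.ofReal (coeff t ℓ / coeffNorm t d)) (by
    have h : ∑ ℓ : Fin (maxIndex t d + 1), coeff t ℓ = coeffNorm t d :=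
      Finset.sum_congr rfl fun ℓ _ => (abs_of_nonneg (coeff_nonneg t ℓ)).symm
    have h2 := ENNReal.ofReal_sum_of_nonneg (s := Finset.univ)
      (f := fun ℓ : Fin (maxIndex t d + 1) => coeff t ℓ / coeffNorm t d)
      (fun ℓ _ => div_nonneg (coeff_nonneg t ℓ) (coeffNorm_pos t d).le)
    rw [← h2, ← Finset.sum_div, h, div_self (coeffNorm_pos t d).ne', ENNReal.ofReal_one])

/-- The circuit run by the algorithm once `ℓ` has been picked: it applies `V` exactly `2ℓ` times
(even `t`) or `2ℓ+1` times (odd `t`). -/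
def powHam (n : Type*) [Fintype n] [DecidableEq n] (t ℓ : ℕ) : Circuit n :=
  List.replicate (power t ℓ) Gate.query

/-- The expected output state `𝔼[ρ]` of the algorithm: pick `ℓ` from `law t d`, then run `powHam`. -/
def expectedOutput {n : Type*} [Fintype n] [DecidableEq n] (t d : ℕ) (V ρ : Matrix n n ℂ) :
    Matrix n n ℂ :=
  ∑ ℓ : Fin (maxIndex t d + 1), (law t d ℓ).toReal • Circuit.run (powHam n t ℓ) V ρ

/-- `∑ ℓ, (c ℓ / ‖c‖₁) V^{2ℓ} ρ (V^{2ℓ})†` for even `t`, and the same with `2ℓ+1` for odd `t`. -/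
def averageState {n : Type*} [Fintype n] [DecidableEq n] (t d : ℕ) (V ρ : Matrix n n ℂ) :
    Matrix n n ℂ :=
  ∑ ℓ : Fin (maxIndex t d + 1),
    (coeff t ℓ / coeffNorm t d) • (V ^ power t ℓ * ρ * (V ^ power t ℓ)ᴴ)

/-- The degree `d = ⌈√(2 t ln(24/ε))⌉`. -/
def degree (t : ℕ) (ε : ℝ) : ℕ := ⌈Real.sqrt (2 * t * Real.log (24 / ε))⌉₊

end AncillaFree

end

open AncillaFree

namespace AncillaFree

/-! ### Binomial sums -/

/-! No Chebyshev identities are needed: a `t`-step random walk produces the expansion. Write `K` for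
`ketZero`, `V` for `walk U`, and `A = KᴴUK`. A unitary `U` with `U ^ 2 = 1` is Hermitian, so `V + Vᴴ
= RU + UR`, and `Kᴴ(V + Vᴴ) = 2AKᴴ` (`ketZero_mul_walk_add`). Hence `(2A)^t = Kᴴ(V + Vᴴ)^t K`. The
binomial theorem turns the right side into a sum of blocks of `V^(2m-t)`, and `V^k` and `V^(-k)`
have the same block. Grouping by `|2m-t|` yields exactly the coefficients `coeff`.

Blocks are contractions, so cutting at `|2m-t| ≤ d` costs at most a binomial tail, bounded by
Chernoff (`norm_pow_sub_truncation_le`). Replacing `H` by `A` costs at most `tδ`. The truncated sum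
is thus within `ε/2` of `H^t`.

Sampling replaces a coherent sum by a mixture. By Cauchy-Schwarz and `‖c‖₁ ≤ 1`, this does not lower
the overlap, and neither does leaving the ancilla unprojected (`le_trace_projection_averageState`).
Only a lower bound is claimed, so no ancilla is needed to combine the powers. -/

/-- The modulus of the position `2m - t` reached by a `t`-step walk with `m` steps to the right. -/
def walkDist (t m : ℕ) : ℕ := ((2 * m : ℤ) - t).natAbs

/-- A nonzero distance is reached at two mirror positions with equal binomials, distance zero at
only one; this is the factor 2 separating `2 ^ (1 - t)` from `2 ^ (-t)`. Beyond distance `t` both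
sides vanish. -/
theorem sum_choose_walkDist_eq (t l : ℕ) :
    ∑ m ∈ (Finset.range (t + 1)).filter (fun m => walkDist t m = power t l), (t.choose m : ℝ) =
      2 ^ t * coeff t l := by
  have h2 : (2 : ℝ) ^ t * 2 ^ (1 - (t : ℤ)) = 2 := by
    rw [← zpow_natCast, ← zpow_add₀ (by norm_num)]; norm_num
  have h1 : (2 : ℝ) ^ t * 2 ^ (-(t : ℤ)) = 1 := by
    rw [← zpow_natCast, ← zpow_add₀ (by norm_num)]; norm_num
  rcases Nat.even_or_odd' t with ⟨s, rfl | rfl⟩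
  · have he : Even (2 * s) := even_two_mul s
    have hs : 2 * s / 2 = s := by omega
    rw [coeff, power, if_pos he, if_pos he, hs]
    rcases Nat.eq_zero_or_pos l with rfl | hl
    · have hF : (Finset.range (2 * s + 1)).filter
          (fun m => walkDist (2 * s) m = 2 * 0) = {s} := by
        ext m; simp [walkDist]; omega
      rw [hF, Finset.sum_singleton, if_pos rfl, ← mul_assoc, h1, one_mul]
    · rw [if_neg hl.ne', ← mul_assoc, h2]
      by_cases hls : l ≤ s
      · have hF : (Finset.range (2 * s + 1)).filter
            (fun m => walkDist (2 * s) m = 2 * l) = {s + l, s - l} := by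
          ext m; simp [walkDist]; omega
        have hc : (2 * s).choose (s - l) = (2 * s).choose (s + l) :=
          Nat.choose_symm_of_eq_add (by omega)
        rw [hF, Finset.sum_pair (by omega), hc]; ring
      · have hF : (Finset.range (2 * s + 1)).filter
            (fun m => walkDist (2 * s) m = 2 * l) = ∅ := by
          ext m; simp [walkDist]; omega
        rw [hF, Nat.choose_eq_zero_of_lt (by omega)]; simp
  · have ho : ¬ Even (2 * s + 1) := by simp
    have hs : (2 * s + 1 + 1) / 2 = s + 1 := by omega
    rw [coeff, power, if_neg ho, if_neg ho, hs, ← mul_assoc, h2]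
    by_cases hls : l ≤ s
    · have hF : (Finset.range (2 * s + 1 + 1)).filter
          (fun m => walkDist (2 * s + 1) m = 2 * l + 1) = {s + 1 + l, s - l} := by
        ext m; simp [walkDist]; omega
      have hc : (2 * s + 1).choose (s - l) = (2 * s + 1).choose (s + 1 + l) :=
        Nat.choose_symm_of_eq_add (by omega)
      rw [hF, Finset.sum_pair (by omega), hc]; ring
    · have hF : (Finset.range (2 * s + 1 + 1)).filter
          (fun m => walkDist (2 * s + 1) m = 2 * l + 1) = ∅ := by
        ext m; simp [walkDist]; omega
      rw [hF, Nat.choose_eq_zero_of_lt (by omega)]; simp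

theorem power_injective (t : ℕ) : Function.Injective (power t) := by
  intro k l h
  unfold power at h
  split_ifs at h <;> omega

/-- `0 < d` matters for odd `t`: at `d = 0` truncated subtraction still admits `l = 0`, whose power
is 1. -/
theorem power_le {t d l : ℕ} (hd : 0 < d) (hl : l ≤ maxIndex t d) : power t l ≤ d := by
  unfold maxIndex at hl
  unfold power
  split_ifs at * <;> omega

theorem exists_power_eq_walkDist {t d m : ℕ} (h : walkDist t m ≤ d) :
    ∃ l ≤ maxIndex t d, power t l = walkDist t m := by
  unfold walkDist at *
  unfold maxIndex power
  split_ifs with ht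
  · obtain ⟨s, rfl⟩ := ht
    exact ⟨((m : ℤ) - s).natAbs, by omega, by omega⟩
  · obtain ⟨s, rfl⟩ := Nat.not_even_iff_odd.1 ht
    exact ⟨(((2 * m : ℤ) - (2 * s + 1 : ℕ)).natAbs - 1) / 2, by omega, by omega⟩

/-- Module-valued so that it serves both for walk blocks and, with `f = 1`, for bounding `‖c‖₁`. -/
theorem sum_choose_smul_of_walkDist_le {M : Type*} [AddCommGroup M] [Module ℝ M] (t : ℕ) {d : ℕ}
    (hd : 0 < d) (f : ℕ → M) :
    ∑ m ∈ (Finset.range (t + 1)).filter (fun m => walkDist t m ≤ d),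
        (t.choose m : ℝ) • f (walkDist t m) =
      (2 : ℝ) ^ t • ∑ l : Fin (maxIndex t d + 1), coeff t l • f (power t l) := by
  rw [Fin.sum_univ_eq_sum_range (fun l => coeff t l • f (power t l)), Finset.smul_sum]
  have hmaps : ∀ m ∈ (Finset.range (t + 1)).filter (fun m => walkDist t m ≤ d),
      walkDist t m ∈ (Finset.range (maxIndex t d + 1)).image (power t) := by
    intro m hm
    obtain ⟨l, hl, h⟩ := exists_power_eq_walkDist (Finset.mem_filter.1 hm).2
    exact Finset.mem_image.2 ⟨l, by simp; omega, h⟩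
  rw [← Finset.sum_fiberwise_of_maps_to hmaps,
    Finset.sum_image fun _ _ _ _ h => power_injective t h]
  refine Finset.sum_congr rfl fun l hl => ?_
  have hle := power_le (t := t) hd (Nat.lt_succ_iff.1 (Finset.mem_range.1 hl))
  rw [smul_smul, ← sum_choose_walkDist_eq, Finset.sum_smul, Finset.filter_filter]
  refine Finset.sum_congr ?_ fun m hm => ?_
  · ext m
    simp only [Finset.mem_filter]
    constructor
    · rintro ⟨h1, -, h2⟩; exact ⟨h1, h2⟩
    · rintro ⟨h1, h2⟩; exact ⟨h1, h2 ▸ hle, h2⟩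
  · rw [(Finset.mem_filter.1 hm).2]

/-! ### Chernoff bound for the binomial tail -/

theorem sum_choose_mul_exp (t : ℕ) (x : ℝ) :
    ∑ m ∈ Finset.range (t + 1), (t.choose m : ℝ) * Real.exp (x * (2 * m - t)) =
      2 ^ t * Real.cosh x ^ t := by
  rw [← mul_pow, Real.cosh_eq, mul_div_cancel₀ _ two_ne_zero, add_pow]
  refine Finset.sum_congr rfl fun m hm => ?_
  have hm' : m ≤ t := Nat.lt_succ_iff.1 (Finset.mem_range.1 hm)
  rw [← Real.exp_nat_mul, ← Real.exp_nat_mul, ← Real.exp_add, mul_comm, Nat.cast_sub hm']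
  ring_nf

theorem sum_choose_lt_walkDist_le {t : ℕ} (ht : 0 < t) (d : ℕ) :
    ∑ m ∈ (Finset.range (t + 1)).filter (fun m => ¬ walkDist t m ≤ d), (t.choose m : ℝ) ≤
      2 ^ t * (2 * Real.exp (-(d ^ 2 / (2 * t)))) := by
  have ht' : (0 : ℝ) < t := by exact_mod_cast ht
  -- This choice minimises the Chernoff exponent `t * x ^ 2 / 2 - x * d`.
  set x : ℝ := d / t with hx
  have hx0 : 0 ≤ x := by positivity
  have hcosh : Real.cosh x ^ t ≤ Real.exp (t * (x ^ 2 / 2)) := by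
    rw [Real.exp_nat_mul]
    exact pow_le_pow_left₀ (Real.cosh_pos x).le (Real.cosh_le_exp_half_sq x) t
  calc ∑ m ∈ (Finset.range (t + 1)).filter (fun m => ¬ walkDist t m ≤ d), (t.choose m : ℝ)
      ≤ ∑ m ∈ (Finset.range (t + 1)).filter (fun m => ¬ walkDist t m ≤ d),
          Real.exp (-(x * d)) * ((t.choose m : ℝ) * Real.exp (x * (2 * m - t)) +
            (t.choose m : ℝ) * Real.exp (-x * (2 * m - t))) := by
        refine Finset.sum_le_sum fun m hm => ?_
        have hm' : d < walkDist t m := not_le.1 (Finset.mem_filter.1 hm).2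
        have habs : (d : ℝ) ≤ |2 * (m : ℝ) - t| := by
          have : ((walkDist t m : ℕ) : ℝ) = |2 * (m : ℝ) - t| := by
            rw [walkDist, Nat.cast_natAbs]; push_cast; rfl
          rw [← this]; exact_mod_cast hm'.le
        -- Two-sided Markov weight: one exponential handles each sign of `2m - t`.
        have hkey : 1 ≤ Real.exp (-(x * d)) *
            (Real.exp (x * (2 * m - t)) + Real.exp (-x * (2 * m - t))) := by
          rw [mul_add, ← Real.exp_add, ← Real.exp_add]
          rcases le_abs.1 habs with h | h
          · have := Real.one_le_exp (x := -(x * d) + x * (2 * m - t)) (by nlinarith)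
            linarith [Real.exp_pos (-(x * d) + -x * (2 * m - t))]
          · have := Real.one_le_exp (x := -(x * d) + -x * (2 * m - t)) (by nlinarith)
            linarith [Real.exp_pos (-(x * d) + x * (2 * m - t))]
        calc (t.choose m : ℝ) = t.choose m * 1 := (mul_one _).symm
          _ ≤ t.choose m * _ := mul_le_mul_of_nonneg_left hkey (Nat.cast_nonneg _)
          _ = _ := by ring
    _ ≤ ∑ m ∈ Finset.range (t + 1),
          Real.exp (-(x * d)) * ((t.choose m : ℝ) * Real.exp (x * (2 * m - t)) +
            (t.choose m : ℝ) * Real.exp (-x * (2 * m - t))) :=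
        Finset.sum_le_sum_of_subset_of_nonneg (Finset.filter_subset _ _)
          fun _ _ _ => by positivity
    _ = 2 ^ t * (2 * (Real.exp (-(x * d)) * Real.cosh x ^ t)) := by
        rw [← Finset.mul_sum, Finset.sum_add_distrib, sum_choose_mul_exp, sum_choose_mul_exp,
          Real.cosh_neg]
        ring
    _ ≤ 2 ^ t * (2 * (Real.exp (-(x * d)) * Real.exp (t * (x ^ 2 / 2)))) := by gcongr
    _ = _ := by
        rw [← Real.exp_add]
        congr 3
        rw [hx]; field_simp; ring

theorem coeffNorm_le_one {t d : ℕ} (hd : 0 < d) : coeffNorm t d ≤ 1 := by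
  have h := sum_choose_smul_of_walkDist_le t hd (fun _ => (1 : ℝ))
  simp only [smul_eq_mul, mul_one] at h
  have h2 : ∑ m ∈ (Finset.range (t + 1)).filter (fun m => walkDist t m ≤ d), (t.choose m : ℝ) ≤
      2 ^ t := by
    calc _ ≤ ∑ m ∈ Finset.range (t + 1), (t.choose m : ℝ) :=
          Finset.sum_le_sum_of_subset_of_nonneg (Finset.filter_subset _ _)
            fun _ _ _ => by positivity
      _ = 2 ^ t := by exact_mod_cast Nat.sum_range_choose t
  have h3 : coeffNorm t d = ∑ l : Fin (maxIndex t d + 1), coeff t l :=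
    Finset.sum_congr rfl fun l _ => abs_of_nonneg (coeff_nonneg t l)
  rw [h, ← h3] at h2
  exact le_of_mul_le_mul_left (by simpa using h2) (pow_pos two_pos t)

end AncillaFree

namespace AncillaFree

/-! ### The walk operator -/

section Walk

variable {ι : Type*} [Fintype ι] [DecidableEq ι] {a : ℕ}

theorem ketZero_conjTranspose_mul_self : (ketZero a ι)ᴴ * ketZero a ι = 1 := by
  ext i j
  simp [ketZero, Matrix.mul_apply, Matrix.one_apply, eq_comm]

theorem ketZero_mul_conjTranspose :
    ketZero a ι * (ketZero a ι)ᴴ = zeroProj a ⊗ₖ (1 : Matrix ι ι ℂ) := by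
  ext ⟨x, i⟩ ⟨y, j⟩
  simp [ketZero, zeroProj, Matrix.mul_apply, Matrix.one_apply, Matrix.single_apply, Prod.ext_iff,
    ite_and, eq_comm]
  split_ifs <;> simp_all

theorem reflection_eq :
    reflection a ι = (2 : ℂ) • (ketZero a ι * (ketZero a ι)ᴴ) - 1 := by
  rw [ketZero_mul_conjTranspose, reflection, sub_eq_add_neg, Matrix.add_kronecker,
    Matrix.smul_kronecker, sub_eq_add_neg, ← neg_one_smul ℂ (1 : Matrix (Fin a → Fin 2) _ ℂ),
    Matrix.smul_kronecker, Matrix.one_kronecker_one, neg_one_smul]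

theorem reflection_conjTranspose : (reflection a ι)ᴴ = reflection a ι := by
  simp [reflection_eq, Matrix.conjTranspose_sub, Matrix.conjTranspose_smul]

theorem reflection_mul_ketZero : reflection a ι * ketZero a ι = ketZero a ι := by
  rw [reflection_eq, Matrix.sub_mul, Matrix.smul_mul, Matrix.mul_assoc,
    ketZero_conjTranspose_mul_self, Matrix.mul_one, Matrix.one_mul, two_smul, add_sub_cancel_right]

theorem ketZero_conjTranspose_mul_reflection :
    (ketZero a ι)ᴴ * reflection a ι = (ketZero a ι)ᴴ := by
  conv_lhs => rw [← reflection_conjTranspose, ← Matrix.conjTranspose_mul, reflection_mul_ketZero]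

theorem reflection_mul_self : reflection a ι * reflection a ι = 1 := by
  nth_rw 1 [reflection_eq]
  rw [Matrix.sub_mul, Matrix.smul_mul, Matrix.mul_assoc, ketZero_conjTranspose_mul_reflection,
    Matrix.one_mul, reflection_eq]
  abel

theorem norm_ketZero_le_one : ‖ketZero a ι‖ ≤ 1 := by
  have h := Matrix.l2_opNorm_conjTranspose_mul_self (ketZero a ι)
  rw [ketZero_conjTranspose_mul_self] at h
  have h1 : ‖(1 : Matrix ι ι ℂ)‖ ≤ 1 := by
    rcases isEmpty_or_nonempty ι with hι | hι
    · rw [Subsingleton.elim (1 : Matrix ι ι ℂ) 0]; simp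
    · exact norm_one.le
  nlinarith [norm_nonneg (ketZero a ι)]

variable {U : Matrix (Reg a ι) (Reg a ι) ℂ}

theorem isHermitian_of_unitary_of_sq {n : Type*} [Fintype n] [DecidableEq n] {U : Matrix n n ℂ}
    (hU : U ∈ Matrix.unitaryGroup n ℂ) (h2 : U ^ 2 = 1) : Uᴴ = U := by
  have h := Matrix.mem_unitaryGroup_iff'.1 hU
  rw [Matrix.star_eq_conjTranspose] at h
  calc Uᴴ = Uᴴ * (U * U) := by rw [← sq, h2, Matrix.mul_one]
    _ = U := by rw [← Matrix.mul_assoc, h, Matrix.one_mul]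

theorem walk_conjTranspose (hU : Uᴴ = U) : (walk U)ᴴ = U * reflection a ι := by
  rw [walk, Matrix.conjTranspose_mul, reflection_conjTranspose, hU]

theorem walk_mem_unitaryGroup (hU : U ∈ Matrix.unitaryGroup (Reg a ι) ℂ) :
    walk U ∈ Matrix.unitaryGroup (Reg a ι) ℂ := by
  refine mul_mem ?_ hU
  rw [Matrix.mem_unitaryGroup_iff, Matrix.star_eq_conjTranspose, reflection_conjTranspose,
    reflection_mul_self]

/-- The operator `⟨0̄| V ^ k |0̄⟩`. -/
def walkBlock (U : Matrix (Reg a ι) (Reg a ι) ℂ) (k : ℕ) : Matrix ι ι ℂ :=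
  (ketZero a ι)ᴴ * walk U ^ k * ketZero a ι

theorem norm_walkBlock_le_one (hU : U ∈ Matrix.unitaryGroup (Reg a ι) ℂ) (k : ℕ) :
    ‖walkBlock U k‖ ≤ 1 := by
  have hV : ‖walk U ^ k‖ ≤ 1 := by
    rcases isEmpty_or_nonempty ι with hι | hι
    · rw [Subsingleton.elim (walk U ^ k) 0]; simp
    · exact (CStarRing.norm_of_mem_unitary (pow_mem (walk_mem_unitaryGroup hU) k)).le
  have hK := norm_ketZero_le_one (a := a) (ι := ι)
  have hK' : ‖(ketZero a ι)ᴴ‖ ≤ 1 := by rwa [Matrix.l2_opNorm_conjTranspose]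
  calc ‖walkBlock U k‖ ≤ ‖(ketZero a ι)ᴴ * walk U ^ k‖ * ‖ketZero a ι‖ := Matrix.l2_opNorm_mul _ _
    _ ≤ ‖(ketZero a ι)ᴴ‖ * ‖walk U ^ k‖ * ‖ketZero a ι‖ := by
        gcongr; exact Matrix.l2_opNorm_mul _ _
    _ ≤ 1 * 1 * 1 := by gcongr
    _ = 1 := by norm_num

/-- Conjugation by `R` inverts the walk: `R(RU)R = UR = Vᴴ`. Inserting `R * R = 1` between factors
gives all powers. -/
theorem reflection_mul_walk_pow_mul_reflection (hU : Uᴴ = U) (k : ℕ) :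
    reflection a ι * walk U ^ k * reflection a ι = (walk U)ᴴ ^ k := by
  induction k with
  | zero => rw [pow_zero, pow_zero, Matrix.mul_one, reflection_mul_self]
  | succ k ih =>
    calc reflection a ι * walk U ^ (k + 1) * reflection a ι
        = reflection a ι * walk U ^ k * (reflection a ι * reflection a ι) * walk U *
            reflection a ι := by
          rw [reflection_mul_self, pow_succ]; simp only [Matrix.mul_assoc, Matrix.one_mul]
      _ = (reflection a ι * walk U ^ k * reflection a ι) * (reflection a ι * reflection a ι) *
            (U * reflection a ι) := by rw [walk]; simp only [Matrix.mul_assoc]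
      _ = (walk U)ᴴ ^ (k + 1) := by
          rw [ih, reflection_mul_self, Matrix.mul_one, ← walk_conjTranspose hU, pow_succ]

theorem ketZero_walk_conjTranspose_pow (hU : Uᴴ = U) (k : ℕ) :
    (ketZero a ι)ᴴ * (walk U)ᴴ ^ k * ketZero a ι = walkBlock U k := by
  rw [← reflection_mul_walk_pow_mul_reflection hU, walkBlock]
  calc _ = ((ketZero a ι)ᴴ * reflection a ι) * walk U ^ k * (reflection a ι * ketZero a ι) := by
        simp only [Matrix.mul_assoc]
    _ = _ := by rw [ketZero_conjTranspose_mul_reflection, reflection_mul_ketZero]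

theorem walkBlock_one : walkBlock U 1 = (ketZero a ι)ᴴ * U * ketZero a ι := by
  rw [walkBlock, pow_one, walk, ← Matrix.mul_assoc, ketZero_conjTranspose_mul_reflection]

/-- After `KᴴR = Kᴴ` and `R = 2KKᴴ - 1`, the two `KᴴU` terms cancel. This intertwining lets powers
of `V + Vᴴ` pass through `Kᴴ`. -/
theorem ketZero_mul_walk_add (hU : Uᴴ = U) :
    (ketZero a ι)ᴴ * (walk U + (walk U)ᴴ) = ((2 : ℂ) • walkBlock U 1) * (ketZero a ι)ᴴ := by
  rw [walk_conjTranspose hU, Matrix.mul_add, walk, ← Matrix.mul_assoc,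
    ketZero_conjTranspose_mul_reflection, walkBlock_one, reflection_eq, Matrix.mul_sub,
    Matrix.mul_one, Matrix.mul_sub]
  simp only [Matrix.mul_smul, Matrix.smul_mul, Matrix.mul_assoc]
  abel

theorem ketZero_mul_walk_add_pow (hU : Uᴴ = U) (t : ℕ) :
    (ketZero a ι)ᴴ * (walk U + (walk U)ᴴ) ^ t =
      ((2 : ℂ) • walkBlock U 1) ^ t * (ketZero a ι)ᴴ := by
  induction t with
  | zero => simp
  | succ t ih =>
    rw [pow_succ, ← Matrix.mul_assoc, ih, Matrix.mul_assoc, ketZero_mul_walk_add hU,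
      ← Matrix.mul_assoc, ← pow_succ]

/-- Cancelling `V` against `Vᴴ` leaves a power of one of them, and both have the same block. -/
theorem walkBlock_walkDist (hUu : U ∈ Matrix.unitaryGroup (Reg a ι) ℂ) (hU : Uᴴ = U) {t m : ℕ}
    (hm : m ≤ t) :
    (ketZero a ι)ᴴ * (walk U ^ m * (walk U)ᴴ ^ (t - m)) * ketZero a ι =
      walkBlock U (walkDist t m) := by
  have hV := Matrix.mem_unitaryGroup_iff.1 (walk_mem_unitaryGroup hUu)
  have hV' := Matrix.mem_unitaryGroup_iff'.1 (walk_mem_unitaryGroup hUu)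
  rw [Matrix.star_eq_conjTranspose] at hV hV'
  have hc : Commute (walk U) (walk U)ᴴ := hV.trans hV'.symm
  have hpow (k : ℕ) : walk U ^ k * (walk U)ᴴ ^ k = 1 := by rw [← hc.mul_pow, hV, one_pow]
  rcases le_total m (t - m) with h | h
  · have hd : t - m = m + walkDist t m := by unfold walkDist; omega
    rw [hd, pow_add, ← Matrix.mul_assoc (walk U ^ m), hpow, Matrix.one_mul,
      ketZero_walk_conjTranspose_pow hU]
  · have hd : m = walkDist t m + (t - m) := by unfold walkDist; omega
    conv_lhs => rw [hd]
    rw [show t - (walkDist t m + (t - m)) = t - m by omega, pow_add, Matrix.mul_assoc (_ ^ _),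
      hpow, Matrix.mul_one, walkBlock]

theorem two_pow_smul_walkBlock_one_pow (hUu : U ∈ Matrix.unitaryGroup (Reg a ι) ℂ) (hU : Uᴴ = U)
    (t : ℕ) :
    (2 : ℝ) ^ t • walkBlock U 1 ^ t =
      ∑ m ∈ Finset.range (t + 1), (t.choose m : ℝ) • walkBlock U (walkDist t m) := by
  have hV := Matrix.mem_unitaryGroup_iff.1 (walk_mem_unitaryGroup hUu)
  have hV' := Matrix.mem_unitaryGroup_iff'.1 (walk_mem_unitaryGroup hUu)
  rw [Matrix.star_eq_conjTranspose] at hV hV'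
  have hc : Commute (walk U) (walk U)ᴴ := hV.trans hV'.symm
  have h := congrArg (· * ketZero a ι) (ketZero_mul_walk_add_pow hU t)
  rw [Matrix.mul_assoc _ (ketZero a ι)ᴴ, ketZero_conjTranspose_mul_self, Matrix.mul_one, smul_pow,
    hc.add_pow, Matrix.mul_sum, Matrix.sum_mul] at h
  have hs : (2 : ℝ) ^ t • walkBlock U 1 ^ t = (2 : ℂ) ^ t • walkBlock U 1 ^ t := by
    rw [← Complex.coe_smul]; norm_num
  rw [hs, ← h]
  refine Finset.sum_congr rfl fun m hm => ?_
  rw [← walkBlock_walkDist hUu hU (Nat.lt_succ_iff.1 (Finset.mem_range.1 hm)), Nat.cast_smul_eq_nsmul,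
    ← nsmul_eq_mul', Matrix.mul_smul, Matrix.smul_mul]

theorem norm_pow_sub_truncation_le (hUu : U ∈ Matrix.unitaryGroup (Reg a ι) ℂ) (hU : Uᴴ = U)
    {t d : ℕ} (ht : 0 < t) (hd : 0 < d) :
    ‖walkBlock U 1 ^ t - ∑ l : Fin (maxIndex t d + 1), coeff t l • walkBlock U (power t l)‖ ≤
      2 * Real.exp (-(d ^ 2 / (2 * t))) := by
  have h := two_pow_smul_walkBlock_one_pow hUu hU t
  rw [← Finset.sum_filter_add_sum_filter_not _ (fun m => walkDist t m ≤ d),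
    sum_choose_smul_of_walkDist_le t hd (walkBlock U), ← sub_eq_iff_eq_add', ← smul_sub] at h
  have h2 : (0 : ℝ) < 2 ^ t := by positivity
  refine le_of_mul_le_mul_left ?_ h2
  calc _ = ‖(2 : ℝ) ^ t • (walkBlock U 1 ^ t -
        ∑ l : Fin (maxIndex t d + 1), coeff t l • walkBlock U (power t l))‖ := by
          rw [norm_smul, Real.norm_of_nonneg h2.le]
    _ ≤ ∑ m ∈ (Finset.range (t + 1)).filter (fun m => ¬ walkDist t m ≤ d), (t.choose m : ℝ) := by
        rw [h]
        refine norm_sum_le_of_le _ fun m _ => ?_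
        rw [norm_smul, Real.norm_of_nonneg (Nat.cast_nonneg _)]
        exact mul_le_of_le_one_right (Nat.cast_nonneg _) (norm_walkBlock_le_one hUu _)
    _ ≤ _ := sum_choose_lt_walkDist_le ht d

end Walk

/-- Telescoping: exchange one factor at a time between contractions. -/
theorem norm_pow_sub_pow_le {R : Type*} [NormedRing R] [NormOneClass R] {x y : R} (hx : ‖x‖ ≤ 1)
    (hy : ‖y‖ ≤ 1) (t : ℕ) : ‖x ^ t - y ^ t‖ ≤ t * ‖x - y‖ := by
  induction t with
  | zero => simp
  | succ t ih =>
    have hyt : ‖y ^ t‖ ≤ 1 := (norm_pow_le y t).trans (pow_le_one₀ (norm_nonneg y) hy)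
    have h : x ^ (t + 1) - y ^ (t + 1) = (x ^ t - y ^ t) * x + y ^ t * (x - y) := by
      rw [pow_succ, pow_succ]; noncomm_ring
    calc ‖x ^ (t + 1) - y ^ (t + 1)‖ ≤ ‖x ^ t - y ^ t‖ * ‖x‖ + ‖y ^ t‖ * ‖x - y‖ := by
          rw [h]; exact (norm_add_le _ _).trans (add_le_add (norm_mul_le _ _) (norm_mul_le _ _))
      _ ≤ t * ‖x - y‖ * 1 + 1 * ‖x - y‖ := by gcongr
      _ = _ := by push_cast; ring

end AncillaFree

namespace AncillaFree

/-! ### States and overlaps -/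

section States

variable {ι : Type*} [Fintype ι]

theorem isStarProjection_one_kronecker {m : Type*} [Fintype m] [DecidableEq m] {P : Matrix ι ι ℂ}
    (hP : IsStarProjection P) : IsStarProjection ((1 : Matrix m m ℂ) ⊗ₖ P) := by
  refine ⟨?_, ?_⟩
  · rw [IsIdempotentElem, ← Matrix.mul_kronecker_mul, Matrix.one_mul, hP.isIdempotentElem.eq]
  · rw [IsSelfAdjoint, Matrix.star_eq_conjTranspose, Matrix.conjTranspose_kronecker,
      Matrix.conjTranspose_one, ← Matrix.star_eq_conjTranspose P, hP.isSelfAdjoint.star_eq]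

theorem trace_pureState (x : EuclideanSpace ℂ ι) : (pureState x).trace = (‖x‖ ^ 2 : ℝ) := by
  rw [EuclideanSpace.norm_sq_eq, Matrix.trace]
  push_cast
  refine Finset.sum_congr rfl fun i _ => ?_
  simp [pureState, Matrix.vecMulVec_apply, Complex.mul_conj, Complex.normSq_eq_norm_sq]

theorem posSemidef_pureState (x : EuclideanSpace ℂ ι) : (pureState x).PosSemidef :=
  Matrix.posSemidef_vecMulVec_self_star fun i => x i

variable [DecidableEq ι] {a : ℕ}

theorem withAncilla_eq (ρ : Matrix ι ι ℂ) :
    withAncilla a ρ = ketZero a ι * ρ * (ketZero a ι)ᴴ := by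
  ext ⟨x, i⟩ ⟨y, j⟩
  simp only [withAncilla, ketZero, zeroProj, Matrix.mul_apply, Matrix.kroneckerMap_apply,
    Matrix.single_apply, Matrix.of_apply, Matrix.conjTranspose_apply, Prod.ext_iff, ite_and]
  simp [eq_comm]
  split_ifs <;> simp_all

theorem ketZero_conjTranspose_mul_one_kronecker (P : Matrix ι ι ℂ) :
    (ketZero a ι)ᴴ * ((1 : Matrix (Fin a → Fin 2) (Fin a → Fin 2) ℂ) ⊗ₖ P) =
      P * (ketZero a ι)ᴴ := by
  ext i ⟨y, j⟩
  simp [ketZero, Matrix.mul_apply, Matrix.one_apply, Prod.ext_iff, Fintype.sum_prod_type, ite_and]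
  split_ifs <;> simp_all [eq_comm]

theorem norm_toLpLin_le {m : Type*} [Fintype m] (M : Matrix m ι ℂ) (x : EuclideanSpace ℂ ι) :
    ‖Matrix.toLpLin 2 2 M x‖ ≤ ‖M‖ * ‖x‖ := Matrix.l2_opNorm_mulVec M x

theorem mul_pureState_mul {m : Type*} [Fintype m] (M : Matrix m ι ℂ) (x : EuclideanSpace ℂ ι) :
    M * pureState x * Mᴴ = pureState (Matrix.toLpLin 2 2 M x) := by
  rw [pureState, pureState, Matrix.mul_vecMulVec, Matrix.vecMulVec_mul]
  congr 1
  ext i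
  simp [Matrix.vecMul, dotProduct, Matrix.mulVec, mul_comm]

/-- By `Q = Q² = Qᴴ` and cyclicity of the trace, overlaps become squared norms of vectors. -/
theorem trace_projection_mul_pureState {m : Type*} [Fintype m] [DecidableEq m] {Q : Matrix m m ℂ}
    (hQ : IsStarProjection Q) (M : Matrix m ι ℂ) (x : EuclideanSpace ℂ ι) :
    (Matrix.trace (Q * (M * pureState x * Mᴴ))).re = ‖Matrix.toLpLin 2 2 (Q * M) x‖ ^ 2 := by
  have hs : Qᴴ = Q := hQ.isSelfAdjoint.star_eq
  have h : Matrix.trace (Q * (M * pureState x * Mᴴ)) =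
      Matrix.trace ((Q * M) * pureState x * (Q * M)ᴴ) := by
    conv_lhs => rw [← hQ.isIdempotentElem.eq, Matrix.mul_assoc, Matrix.trace_mul_comm]
    rw [Matrix.conjTranspose_mul, hs]
    simp only [Matrix.mul_assoc]
  rw [h, mul_pureState_mul, trace_pureState, Complex.ofReal_re]

theorem run_powHam {n : Type*} [Fintype n] [DecidableEq n] (t l : ℕ) (V ρ : Matrix n n ℂ) :
    Circuit.run (powHam n t l) V ρ = V ^ power t l * ρ * (V ^ power t l)ᴴ := by
  unfold Circuit.run powHam
  generalize power t l = k
  induction k generalizing ρ with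
  | zero => simp
  | succ k ih =>
    rw [List.replicate_succ, List.foldl_cons, ih, Gate.apply, pow_succ, Matrix.conjTranspose_mul]
    simp only [Matrix.mul_assoc]

theorem queries_powHam (n : Type*) [Fintype n] [DecidableEq n] (t l : ℕ) :
    Circuit.queries (powHam n t l) = power t l := by
  simp [Circuit.queries, powHam, Gate.cost]

theorem expectedOutput_eq_averageState {n : Type*} [Fintype n] [DecidableEq n] (t d : ℕ)
    (V ρ : Matrix n n ℂ) : expectedOutput t d V ρ = averageState t d V ρ := by
  refine Finset.sum_congr rfl fun l _ => ?_
  rw [run_powHam]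
  congr 1
  exact ENNReal.toReal_ofReal (div_nonneg (coeff_nonneg t l) (coeffNorm_pos t d).le)

theorem isDensityMatrix_run_powHam {U : Matrix (Reg a ι) (Reg a ι) ℂ}
    (hU : U ∈ Matrix.unitaryGroup (Reg a ι) ℂ) {ψ : EuclideanSpace ℂ ι} (hψ : ‖ψ‖ = 1)
    (t l : ℕ) :
    IsDensityMatrix (Circuit.run (powHam (Reg a ι) t l) (walk U) (withAncilla a (pureState ψ))) := by
  have hV := Matrix.mem_unitaryGroup_iff'.1 (pow_mem (walk_mem_unitaryGroup hU) (power t l))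
  rw [Matrix.star_eq_conjTranspose] at hV
  rw [run_powHam, withAncilla_eq]
  constructor
  · rw [mul_pureState_mul, mul_pureState_mul]
    exact posSemidef_pureState _
  · rw [Matrix.trace_mul_comm, ← Matrix.mul_assoc, hV, Matrix.one_mul, Matrix.trace_mul_comm,
      ← Matrix.mul_assoc, ketZero_conjTranspose_mul_self, Matrix.one_mul, trace_pureState, hψ]
    norm_num

/-- `P` commutes past `Kᴴ` as `1 ⊗ₖ P`, and `Kᴴ` is a contraction: projecting the ancilla onto zero
can only lose weight. -/
theorem norm_projection_walkBlock_le (U : Matrix (Reg a ι) (Reg a ι) ℂ) (P : Matrix ι ι ℂ)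
    (ψ : EuclideanSpace ℂ ι) (k : ℕ) :
    ‖Matrix.toLpLin 2 2 (P * walkBlock U k) ψ‖ ≤
      ‖Matrix.toLpLin 2 2 (((1 : Matrix (Fin a → Fin 2) (Fin a → Fin 2) ℂ) ⊗ₖ P) *
        (walk U ^ k * ketZero a ι)) ψ‖ := by
  have h : P * walkBlock U k = (ketZero a ι)ᴴ *
      (((1 : Matrix (Fin a → Fin 2) (Fin a → Fin 2) ℂ) ⊗ₖ P) * (walk U ^ k * ketZero a ι)) := by
    rw [← Matrix.mul_assoc (ketZero a ι)ᴴ, ketZero_conjTranspose_mul_one_kronecker, walkBlock]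
    simp only [Matrix.mul_assoc]
  rw [h, Matrix.toLpLin_mul_same, LinearMap.comp_apply]
  refine (norm_toLpLin_le _ _).trans (mul_le_of_le_one_left (norm_nonneg _) ?_)
  rw [Matrix.l2_opNorm_conjTranspose]
  exact norm_ketZero_le_one

/-- Triangle inequality, then weighted Cauchy-Schwarz. -/
theorem norm_sum_smul_sq_le {κ E : Type*} [SeminormedAddCommGroup E] [NormedSpace ℝ E]
    (s : Finset κ) {w : κ → ℝ} (hw : ∀ i ∈ s, 0 ≤ w i) (x : κ → E) :
    ‖∑ i ∈ s, w i • x i‖ ^ 2 ≤ (∑ i ∈ s, w i) * ∑ i ∈ s, w i * ‖x i‖ ^ 2 := by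
  have h : ‖∑ i ∈ s, w i • x i‖ ≤ ∑ i ∈ s, w i * ‖x i‖ :=
    norm_sum_le_of_le _ fun i hi => by rw [norm_smul, Real.norm_of_nonneg (hw i hi)]
  refine (pow_le_pow_left₀ (norm_nonneg _) h 2).trans ?_
  exact Finset.sum_sq_le_sum_mul_sum_of_sq_le_mul s hw
    (fun i hi => mul_nonneg (hw i hi) (sq_nonneg _)) fun i _ => (by ring : _ = _).le

theorem trace_projection_averageState (U : Matrix (Reg a ι) (Reg a ι) ℂ) {P : Matrix ι ι ℂ}
    (hP : IsStarProjection P) (ψ : EuclideanSpace ℂ ι) (t d : ℕ) :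
    (Matrix.trace (((1 : Matrix (Fin a → Fin 2) (Fin a → Fin 2) ℂ) ⊗ₖ P) *
        averageState t d (walk U) (withAncilla a (pureState ψ)))).re =
      ∑ l : Fin (maxIndex t d + 1), coeff t l / coeffNorm t d *
        ‖Matrix.toLpLin 2 2 (((1 : Matrix (Fin a → Fin 2) (Fin a → Fin 2) ℂ) ⊗ₖ P) *
          (walk U ^ power t l * ketZero a ι)) ψ‖ ^ 2 := by
  rw [averageState, Matrix.mul_sum, Matrix.trace_sum, Complex.re_sum]
  refine Finset.sum_congr rfl fun l _ => ?_
  rw [← trace_projection_mul_pureState (isStarProjection_one_kronecker hP), Matrix.mul_smul,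
    Matrix.trace_smul, Complex.smul_re, smul_eq_mul, withAncilla_eq, Matrix.conjTranspose_mul]
  simp only [Matrix.mul_assoc]

theorem le_trace_projection_averageState (U : Matrix (Reg a ι) (Reg a ι) ℂ) {P : Matrix ι ι ℂ}
    (hP : IsStarProjection P) (ψ : EuclideanSpace ℂ ι) (t : ℕ) {d : ℕ} (hd : 0 < d) :
    ‖Matrix.toLpLin 2 2 (P * ∑ l : Fin (maxIndex t d + 1),
        coeff t l • walkBlock U (power t l)) ψ‖ ^ 2 ≤
      (Matrix.trace (((1 : Matrix (Fin a → Fin 2) (Fin a → Fin 2) ℂ) ⊗ₖ P) *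
        averageState t d (walk U) (withAncilla a (pureState ψ)))).re := by
  have hpos := coeffNorm_pos t d
  have hle := coeffNorm_le_one (t := t) hd
  have hc : ∑ l : Fin (maxIndex t d + 1), coeff t l = coeffNorm t d :=
    Finset.sum_congr rfl fun l _ => (abs_of_nonneg (coeff_nonneg t l)).symm
  have hlin : Matrix.toLpLin 2 2 (P * ∑ l : Fin (maxIndex t d + 1),
        coeff t l • walkBlock U (power t l)) ψ =
      ∑ l : Fin (maxIndex t d + 1),
        coeff t l • Matrix.toLpLin 2 2 (P * walkBlock U (power t l)) ψ := by
    rw [Matrix.mul_sum, map_sum, LinearMap.sum_apply]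
    refine Finset.sum_congr rfl fun l _ => ?_
    rw [Matrix.mul_smul, ← Complex.coe_smul, map_smul, LinearMap.smul_apply, Complex.coe_smul]
  rw [trace_projection_averageState U hP, hlin]
  refine (norm_sum_smul_sq_le Finset.univ (w := fun l : Fin (maxIndex t d + 1) => coeff t l)
    (fun l _ => coeff_nonneg t l)
    fun l : Fin (maxIndex t d + 1) => Matrix.toLpLin 2 2 (P * walkBlock U (power t l)) ψ).trans ?_
  rw [hc]
  have hnn : 0 ≤ ∑ l : Fin (maxIndex t d + 1),
      coeff t l * ‖Matrix.toLpLin 2 2 (P * walkBlock U (power t l)) ψ‖ ^ 2 :=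
    Finset.sum_nonneg fun l _ => mul_nonneg (coeff_nonneg t l) (sq_nonneg _)
  -- `‖c‖₁ ≤ 1` is used twice: to drop the Cauchy-Schwarz prefactor, and below to pass from `c` to
  -- the larger normalised weights.
  refine (mul_le_of_le_one_left hnn hle).trans (Finset.sum_le_sum fun l _ => ?_)
  have hcl := coeff_nonneg t l
  have h1 : coeff t l ≤ coeff t l / coeffNorm t d := le_div_self hcl hpos hle
  gcongr
  exact norm_projection_walkBlock_le U P ψ _

end States

theorem sq_sub_le_sq_of_sub_le {x y ε : ℝ} (hε : 0 ≤ ε) (hx : x ≤ 1) (hx0 : 0 ≤ x) (hy0 : 0 ≤ y)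
    (h : x - y ≤ ε / 2) : x ^ 2 - ε ≤ y ^ 2 := by
  rcases le_total x y with hxy | hxy
  · linarith [pow_le_pow_left₀ hx0 hxy 2]
  · have : (x - y) * (x + y) ≤ ε / 2 * 2 := by gcongr; linarith
    linarith [sq_sub_sq x y]

/-! ### The degree -/

theorem one_lt_log_div {ε : ℝ} (hε : 0 < ε) (hε1 : ε < 1) : 1 < Real.log (24 / ε) := by
  rw [Real.lt_log_iff_exp_lt (by positivity)]
  have : (24 : ℝ) < 24 / ε := by rw [lt_div_iff₀ hε]; linarith
  linarith [Real.exp_one_lt_d9]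

theorem degree_pos {t : ℕ} (ht : 0 < t) {ε : ℝ} (hε : 0 < ε) (hε1 : ε < 1) : 0 < degree t ε := by
  have := one_lt_log_div hε hε1
  have : (0 : ℝ) < t := by exact_mod_cast ht
  exact Nat.ceil_pos.2 (Real.sqrt_pos.2 (by positivity))

theorem exp_neg_degree_sq_le {t : ℕ} (ht : 0 < t) {ε : ℝ} (hε : 0 < ε) (hε1 : ε < 1) :
    2 * Real.exp (-((degree t ε : ℝ) ^ 2 / (2 * t))) ≤ ε / 12 := by
  have hlog := one_lt_log_div hε hε1
  have ht' : (0 : ℝ) < t := by exact_mod_cast ht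
  have hd : Real.sqrt (2 * t * Real.log (24 / ε)) ≤ degree t ε := Nat.le_ceil _
  have hd2 : 2 * t * Real.log (24 / ε) ≤ (degree t ε : ℝ) ^ 2 :=
    (Real.sqrt_le_left (by positivity)).1 hd
  have h : Real.log (24 / ε) ≤ (degree t ε : ℝ) ^ 2 / (2 * t) := by
    rw [le_div_iff₀ (by positivity)]; linarith
  calc 2 * Real.exp (-((degree t ε : ℝ) ^ 2 / (2 * t)))
      ≤ 2 * Real.exp (-Real.log (24 / ε)) := by gcongr
    _ = ε / 12 := by
        rw [Real.exp_neg, Real.exp_log (by positivity)]; field_simp; norm_num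

/-- `log (24 / ε)` exceeds `log (1 / ε)` by the constant `log 24`. Since `log (1 / ε)` vanishes as
`ε` tends to 1, absorbing that constant requires `ε ≤ ε₀ < 1`. -/
theorem degree_le {t : ℕ} (ht : 0 < t) {ε ε₀ : ℝ} (hε : 0 < ε) (hε₀ : ε ≤ ε₀) (hε₀' : ε₀ < 1) :
    (degree t ε : ℝ) ≤
      2 * Real.sqrt (2 * (1 + Real.log 24 / Real.log (1 / ε₀))) *
        Real.sqrt (t * Real.log (1 / ε)) := by
  have hlog := one_lt_log_div hε (hε₀.trans_lt hε₀')
  have ht' : (1 : ℝ) ≤ t := by exact_mod_cast ht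
  have hε₀0 : 0 < ε₀ := hε.trans_le hε₀
  have hL0 : 0 < Real.log (1 / ε₀) := Real.log_pos (by rw [lt_div_iff₀ hε₀0]; linarith)
  have hL : Real.log (1 / ε₀) ≤ Real.log (1 / ε) := by gcongr
  have h24 : 0 < Real.log 24 := Real.log_pos (by norm_num)
  have hs : Real.log (24 / ε) = Real.log 24 + Real.log (1 / ε) := by
    rw [← Real.log_mul (by norm_num) (by positivity), mul_one_div]
  have hb : Real.log (24 / ε) ≤
      (1 + Real.log 24 / Real.log (1 / ε₀)) * Real.log (1 / ε) := by
    have : Real.log 24 ≤ Real.log 24 / Real.log (1 / ε₀) * Real.log (1 / ε) := by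
      rw [div_mul_eq_mul_div, le_div_iff₀ hL0]; gcongr
    rw [hs]; linarith
  -- The root is at least 1, so doubling it absorbs the `+ 1` of the ceiling.
  have h1 : 1 ≤ Real.sqrt (2 * t * Real.log (24 / ε)) := by
    rw [Real.one_le_sqrt]; nlinarith
  have hd : (degree t ε : ℝ) < Real.sqrt (2 * t * Real.log (24 / ε)) + 1 :=
    Nat.ceil_lt_add_one (Real.sqrt_nonneg _)
  calc (degree t ε : ℝ) ≤ 2 * Real.sqrt (2 * t * Real.log (24 / ε)) := by linarith
    _ ≤ 2 * Real.sqrt (2 * (1 + Real.log 24 / Real.log (1 / ε₀)) *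
          (t * Real.log (1 / ε))) := by
        gcongr 2 * Real.sqrt ?_
        calc 2 * t * Real.log (24 / ε) ≤ 2 * t *
              ((1 + Real.log 24 / Real.log (1 / ε₀)) * Real.log (1 / ε)) := by gcongr
          _ = _ := by ring
    _ = _ := by rw [Real.sqrt_mul (by positivity), mul_assoc]

theorem mul_precision_le {t : ℕ} (ht : 0 < t) {ε δ : ℝ} (hε : 0 < ε) (hε1 : ε < 1)
    (hδ : δ ≤ ε ^ 2 / (1152 * t * Real.log (24 / ε))) : t * δ ≤ ε / 12 := by
  have hlog := one_lt_log_div hε hε1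
  have ht' : (0 : ℝ) < t := by exact_mod_cast ht
  calc t * δ ≤ t * (ε ^ 2 / (1152 * t * Real.log (24 / ε))) := by gcongr
    _ = ε ^ 2 / (1152 * Real.log (24 / ε)) := by field_simp
    _ ≤ ε / 12 := by
        rw [div_le_div_iff₀ (by positivity) (by norm_num)]
        nlinarith

/-! ### Total error and the main theorem -/

theorem norm_le_one_of_isStarProjection {n : Type*} [Fintype n] [DecidableEq n] {P : Matrix n n ℂ}
    (hP : IsStarProjection P) : ‖P‖ ≤ 1 := by
  have h := Matrix.l2_opNorm_conjTranspose_mul_self P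
  rw [← Matrix.star_eq_conjTranspose, hP.isSelfAdjoint.star_eq, hP.isIdempotentElem.eq] at h
  nlinarith [norm_nonneg P]

theorem trace_projection_pow_sub_le {ι : Type*} [Fintype ι] [DecidableEq ι] {a t : ℕ} {ε δ : ℝ}
    {H : Matrix ι ι ℂ} {U : Matrix (Reg a ι) (Reg a ι) ℂ} (ht : 0 < t) (hε : 0 < ε) (hε1 : ε < 1)
    (hH : H.IsHermitian) (hH1 : ‖H‖ = 1) (hU : IsBlockEncoding 1 a δ H U) (hU2 : U ^ 2 = 1)
    (hδ : δ ≤ ε ^ 2 / (1152 * t * Real.log (24 / ε))) {ψ : EuclideanSpace ℂ ι} (hψ : ‖ψ‖ = 1)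
    {P : Matrix ι ι ℂ} (hP : IsStarProjection P) :
    (Matrix.trace (P * (H ^ t * pureState ψ * H ^ t))).re - ε ≤
      (Matrix.trace (((1 : Matrix (Fin a → Fin 2) (Fin a → Fin 2) ℂ) ⊗ₖ P) *
        averageState t (degree t ε) (walk U) (withAncilla a (pureState ψ)))).re := by
  obtain ⟨-, hUu, henc⟩ := hU
  -- The telescoping bound needs `‖1‖ = 1`, which fails in dimension zero; the unit vector rules
  -- that out.
  have hι : Nonempty ι := by
    by_contra hι
    rw [not_nonempty_iff] at hι
    rw [Subsingleton.elim ψ 0, norm_zero] at hψ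
    exact zero_ne_one hψ
  have hUh := isHermitian_of_unitary_of_sq hUu hU2
  have hP1 := norm_le_one_of_isStarProjection hP
  have hd := degree_pos ht hε hε1
  rw [Complex.ofReal_one, one_smul, ← walkBlock_one] at henc
  set S := ∑ l : Fin (maxIndex t (degree t ε) + 1), coeff t l • walkBlock U (power t l) with hS
  -- Encoding error and truncation error are each at most `ε / 12`.
  have hHS : ‖H ^ t - S‖ ≤ ε / 2 := by
    have h1 := norm_pow_sub_pow_le hH1.le (norm_walkBlock_le_one hUu 1) t
    have h2 := norm_pow_sub_truncation_le hUu hUh ht hd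
    have h3 := norm_sub_le_norm_sub_add_norm_sub (H ^ t) (walkBlock U 1 ^ t) S
    have h4 := exp_neg_degree_sq_le ht hε hε1
    have h5 := mul_precision_le ht hε hε1 hδ
    have h6 : t * ‖H - walkBlock U 1‖ ≤ t * δ := by gcongr
    linarith
  refine le_trans ?_ (le_trace_projection_averageState U hP ψ t hd)
  have hHt : (H ^ t)ᴴ = H ^ t := (hH.pow t).eq
  have htr := trace_projection_mul_pureState hP (H ^ t) ψ
  rw [hHt] at htr
  rw [htr]
  refine sq_sub_le_sq_of_sub_le hε.le ?_ (norm_nonneg _) (norm_nonneg _) ?_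
  · refine (norm_toLpLin_le _ _).trans ?_
    rw [hψ, mul_one]
    refine (norm_mul_le _ _).trans (mul_le_one₀ hP1 (norm_nonneg _) ?_)
    exact (norm_pow_le H t).trans (by rw [hH1, one_pow])
  · refine (norm_sub_norm_le _ _).trans ?_
    rw [← LinearMap.sub_apply, ← map_sub, ← Matrix.mul_sub]
    refine (norm_toLpLin_le _ _).trans ?_
    rw [hψ, mul_one]
    refine (norm_mul_le _ _).trans ?_
    exact (mul_le_of_le_one_left (norm_nonneg _) hP1).trans hHS

end AncillaFree

open AncillaFree
theorem mainTheorem9 (ε₀ : ℝ) (hε₀ : 0 < ε₀) (hε₀' : ε₀ < 1) :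
    ∃ C : ℝ, 0 < C ∧
      ∀ (ι : Type*) [Fintype ι] [DecidableEq ι] (a t : ℕ) (ε δ : ℝ)
        (H : Matrix ι ι ℂ) (U : Matrix (Reg a ι) (Reg a ι) ℂ),
        0 < t → 0 < ε → ε < 1 →
        H.IsHermitian → ‖H‖ = 1 →
        IsBlockEncoding 1 a δ H U → U ^ 2 = 1 →
        δ ≤ ε ^ 2 / (1152 * t * Real.log (24 / ε)) →
        ∀ (ψ : EuclideanSpace ℂ ι) (P : Matrix ι ι ℂ), ‖ψ‖ = 1 → IsStarProjection P →
          -- every run outputs a density matrix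
          (∀ ℓ : Fin (maxIndex t (degree t ε) + 1), IsDensityMatrix
            (Circuit.run (powHam (Reg a ι) t ℓ) (walk U) (withAncilla a (pureState ψ)))) ∧
          -- the expected output state is the average state
          expectedOutput t (degree t ε) (walk U) (withAncilla a (pureState ψ)) =
            averageState t (degree t ε) (walk U) (withAncilla a (pureState ψ)) ∧
          -- its overlap with the projector
          (Matrix.trace (((1 : Matrix (Fin a → Fin 2) (Fin a → Fin 2) ℂ) ⊗ₖ P) *
              averageState t (degree t ε) (walk U) (withAncilla a (pureState ψ)))).re ≥
            (Matrix.trace (P * (H ^ t * pureState ψ * H ^ t))).re - ε ∧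
          -- the number of queries to the walk operator, in every run
          (∀ ℓ : Fin (maxIndex t (degree t ε) + 1),
            Circuit.queries (powHam (Reg a ι) t ℓ) ≤ degree t ε ∧
            (ε ≤ ε₀ → (Circuit.queries (powHam (Reg a ι) t ℓ) : ℝ) ≤
              C * Real.sqrt (t * Real.log (1 / ε)))) := by
  have hlog : 0 < Real.log (1 / ε₀) := Real.log_pos (by rw [lt_div_iff₀ hε₀]; linarith)
  have h24 : 0 < Real.log 24 := Real.log_pos (by norm_num)
  refine ⟨2 * Real.sqrt (2 * (1 + Real.log 24 / Real.log (1 / ε₀))), by positivity, ?_⟩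
  intro ι _ _ a t ε δ H U ht hε hε1 hH hH1 hU hU2 hδ ψ P hψ hP
  refine ⟨fun l => isDensityMatrix_run_powHam hU.2.1 hψ t l,
    expectedOutput_eq_averageState t _ _ _,
    trace_projection_pow_sub_le ht hε hε1 hH hH1 hU hU2 hδ hψ hP, fun l => ?_⟩
  have hq : Circuit.queries (powHam (Reg a ι) t l) ≤ degree t ε := by
    rw [queries_powHam]
    exact power_le (degree_pos ht hε hε1) (Nat.lt_succ_iff.1 l.2)
  exact ⟨hq, fun h => (Nat.cast_le.2 hq).trans (degree_le ht hε h hε₀')⟩
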